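/- Let $K$ be a field of characteristic zero and let $L=\bigoplus_{n\ge 1}L_n$ be a graded Lie algebra over $K$ (an ordinary Lie algebra with $[L_i,L_j]\subseteq L_{i+j}$). Let $\hat L=\prod_{n\ge1}L_n$ be its completion. Let $U(L)$ be the enveloping algebra with its induced grading, its coproduct $\Delta$ (with $\Delta(l)=l\otimes1+1\otimes l$ for $l\in L$) and its antipode $S$, and let $\hat U(L)=\prod_{n\ge0}U(L)_n$. Let $\delta$ be a graded Lie derivation of $L$: a $K$-linear map with $\delta([a,b])=[\delta(a),b]+[a,\delta(b)]$ and $\delta(L_n)\subseteq L_n$ for all $n$. Write $\delta$ also for its unique extension to a derivation of $U(L)$, and put $D_\delta:=S*\delta=\mu\circ(S\otimes\delta)\circ\Delta$, where $\mu$ is the product of $U(L)$. The maps $\delta$ and $D_\delta$ preserve the grading; extend them degree by degree to $\hat L$ (for $\delta$) and to $\hat U(L)$. **Theorem (Magnus-type formula).** For every $l\in\hat L$ (in particular for every $l\in L$), in $\hat U(L)$, $$D_\delta(\exp l)=\exp(-l)\cdot\delta(\exp l)=\frac{\exp(-\mathrm{ad}_l)-1}{-\mathrm{ad}_l}\,\delta(l),$$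 where $\mathrm{ad}_l(x)=[l,x]$ and $\frac{\exp(-\mathrm{ad}_l)-1}{-\mathrm{ad}_l}:=\sum_{i\ge0}\frac{1}{(i+1)!}(-\mathrm{ad}_l)^i$; the right-hand side is (the image in $\hat U(L)$ of) an element of $\hat L$. Moreover, the classical Magnus formula holds, in the following form. Let $\mathbb A$ be a unital normed algebra over $\mathbb R$ (an algebra of operators), let $A:\mathbb R\to\mathbb A$, and let $X(t)\in\mathbb A[[\lambda]]$ ($t\in\mathbb R$) be a family of formal power series in $\lambda$ with $X(0)=1$, whose coefficients are differentiable in $t$. Let $\Omega(t)=\log X(t)$, that is, $\Omega(t)\in\lambda\mathbb A[[\lambda]]$ and $\exp\Omega(t)=X(t)$ for all $t$. Derivatives in $t$ are taken coefficientwise, and $B_n$ are the Bernoulli numbers ($B_1=-\tfrac12$). * If $X'(t)=X(t)\,\lambda A(t)$ for all $t$, then the coefficients of $\Omega$ are differentiable and $$\Omega'(t)=\frac{-\mathrm{ad}_{\Omega(t)}}{\exp(-\mathrm{ad}_{\Omega(t)})-1}(\lambda A(t))=\sum_{n\ge0}\frac{B_n}{n!}\,(-\mathrm{ad}_{\Omega(t)})^n(\lambda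 A(t)).$$ * If $X'(t)=\lambda A(t)\,X(t)$ for all $t$, then the coefficients of $\Omega$ are differentiable and $$\Omega'(t)=\frac{\mathrm{ad}_{\Omega(t)}}{\exp(\mathrm{ad}_{\Omega(t)})-1}(\lambda A(t))=\sum_{n\ge0}\frac{B_n}{n!}\,\mathrm{ad}_{\Omega(t)}^n(\lambda A(t)).$$ -/

import Mathlib

open scoped TensorProduct PowerSeries

/-!
Conventions.  `K` is a field of characteristic zero, `L` a Lie algebra over `K` with a grading
`ℒ : ℕ → Submodule K L` (the theorem assumes `ℒ 0 = ⊥`, that is `L = ⨁_{n ≥ 1} L_n`), and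
`U(L)` is the universal enveloping algebra.
-/

namespace LogDer

/-! ### Formal exponential and adjoint action on power series over an associative algebra -/

section Formal

variable (K : Type*) [Field K] {R : Type*} [Ring R] [Algebra K R]

/-- If `x` has no constant term then `x ^ k` has no term of degree `< k`. -/
theorem coeff_pow_of_lt (x : R⟦X⟧) (hx : PowerSeries.coeff 0 x = 0) {n k : ℕ} (h : n < k) :
    PowerSeries.coeff n (x ^ k) = 0 := by
  induction k generalizing n with
  | zero => omega
  | succ k ih =>
    rw [pow_succ, PowerSeries.coeff_mul]
    refine Finset.sum_eq_zero fun p hp => ?_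
    have hp' := Finset.HasAntidiagonal.mem_antidiagonal.mp hp
    rcases Nat.eq_zero_or_pos p.2 with h2 | h2
    · rw [h2, hx, mul_zero]
    · rw [ih (by omega), zero_mul]

/-- `exp x = ∑ₖ xᵏ / k!` for a series `x` without constant term.  In degree `n` only the terms
with `k ≤ n` can be nonzero (`coeff_pow_of_lt`). -/
noncomputable def formalExp (x : R⟦X⟧) : R⟦X⟧ :=
  PowerSeries.mk fun n =>
    ∑ k ∈ Finset.range (n + 1), ((k.factorial : K)⁻¹) • PowerSeries.coeff n (x ^ k)

/-- `ad_x : y ↦ x y - y x`. -/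
noncomputable def formalAd (x : R⟦X⟧) : Module.End K R⟦X⟧ :=
  LinearMap.mulLeft K x - LinearMap.mulRight K x

/-- `(c(T))(y) = ∑ₖ cₖ Tᵏ(y)` for a power series `c` and an endomorphism `T` that raises degrees
(so that in degree `n` only the terms with `k ≤ n` can be nonzero). -/
noncomputable def formalApply (c : K⟦X⟧) (T : Module.End K R⟦X⟧) (y : R⟦X⟧) : R⟦X⟧ :=
  PowerSeries.mk fun n =>
    ∑ k ∈ Finset.range (n + 1), PowerSeries.coeff k c • PowerSeries.coeff n ((T ^ k) y)

end Formal

/-! ### The two power series of the Magnus formulas -/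

section Series

variable (K : Type*) [Field K]

/-- The power series `(exp(-x) - 1) / (-x) = ∑ᵢ (-1)ⁱ xⁱ / (i+1)!`. -/
noncomputable def expNegQuot : K⟦X⟧ :=
  PowerSeries.mk fun i => (-1) ^ i / ((i + 1).factorial : K)

theorem neg_X_mul_expNegQuot [CharZero K] :
    -PowerSeries.X * expNegQuot K
      = PowerSeries.evalNegHom (PowerSeries.exp K) - 1 := by
  ext n
  cases n with
  | zero =>
    rw [neg_mul, map_neg, PowerSeries.coeff_zero_X_mul, map_sub, PowerSeries.coeff_one,
      PowerSeries.evalNegHom, PowerSeries.coeff_rescale, PowerSeries.coeff_exp]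
    simp
  | succ n =>
    rw [neg_mul, map_neg, PowerSeries.coeff_succ_X_mul, map_sub, PowerSeries.coeff_one,
      PowerSeries.evalNegHom, PowerSeries.coeff_rescale, PowerSeries.coeff_exp, expNegQuot,
      PowerSeries.coeff_mk, if_neg (Nat.succ_ne_zero n)]
    simp only [map_div₀, map_one, map_natCast]
    ring

/-- The power series `x / (exp x - 1) = ∑ₙ Bₙ xⁿ / n!`, where `B₁ = -1/2`. -/
noncomputable def bernoulliSeries [CharZero K] : K⟦X⟧ :=
  PowerSeries.mk fun n => ((bernoulli n : ℚ) : K) / (n.factorial : K)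

theorem bernoulliSeries_mul_exp_sub_one [CharZero K] :
    bernoulliSeries K * (PowerSeries.exp K - 1) = PowerSeries.X := by
  have h : bernoulliSeries K = bernoulliPowerSeries K := by
    ext n
    simp [bernoulliSeries, bernoulliPowerSeries]
  rw [h, bernoulliPowerSeries_mul_exp_sub_one]

end Series

/-! ### The enveloping algebra: coproduct, antipode, convolution, derivations -/

section Enveloping

attribute [local instance 100] LieRing.ofAssociativeRing

variable (K : Type*) [Field K] (L : Type*) [LieRing L] [LieAlgebra K L]

local notation "U" => UniversalEnvelopingAlgebra K L

/-- The coproduct of `U(L)`: the algebra map with `Δ(l) = l ⊗ 1 + 1 ⊗ l` for `l ∈ L`. -/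
noncomputable def comul : U →ₐ[K] U ⊗[K] U :=
  UniversalEnvelopingAlgebra.lift K
    { toFun := fun l => UniversalEnvelopingAlgebra.ι K l ⊗ₜ[K] 1
        + 1 ⊗ₜ[K] UniversalEnvelopingAlgebra.ι K l
      map_add' := fun a b => by
        rw [map_add, TensorProduct.add_tmul, TensorProduct.tmul_add]; abel
      map_smul' := fun c a => by
        rw [map_smul, RingHom.id_apply, smul_add, TensorProduct.smul_tmul',
          TensorProduct.tmul_smul]
      map_lie' := fun {a b} => by
        simp only [LieHom.map_lie, LieRing.of_associative_ring_bracket, mul_add, add_mul,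
          Algebra.TensorProduct.tmul_mul_tmul, mul_one, one_mul, TensorProduct.sub_tmul,
          TensorProduct.tmul_sub]
        abel }

/-- The antipode of `U(L)` as an algebra map to the opposite algebra: `S(l) = -l` for `l ∈ L`. -/
noncomputable def antipodeOp : U →ₐ[K] Uᵐᵒᵖ :=
  UniversalEnvelopingAlgebra.lift K
    { toFun := fun l => MulOpposite.op (-UniversalEnvelopingAlgebra.ι K l)
      map_add' := fun a b => by
        rw [map_add, neg_add, MulOpposite.op_add]
      map_smul' := fun c a => by
        rw [map_smul, RingHom.id_apply, ← smul_neg, MulOpposite.op_smul]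
      map_lie' := fun {a b} => by
        simp only [LieHom.map_lie, LieRing.of_associative_ring_bracket, ← MulOpposite.op_mul,
          ← MulOpposite.op_sub]
        congr 1
        noncomm_ring }

/-- The antipode `S` of `U(L)`, the anti-automorphism with `S(l) = -l` for `l ∈ L`. -/
noncomputable def antipode : U →ₗ[K] U :=
  (MulOpposite.opLinearEquiv K).symm.toLinearMap ∘ₗ (antipodeOp K L).toLinearMap

/-- The convolution product `f ∗ g = μ ∘ (f ⊗ g) ∘ Δ` of endomorphisms of `U(L)`. -/
noncomputable def convolution (f g : U →ₗ[K] U) : U →ₗ[K] U :=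
  LinearMap.mul' K U ∘ₗ TensorProduct.map f g ∘ₗ (comul K L).toLinearMap

variable {K L}

/-- The algebra map `x ↦ x + ε δ(x)`, `ε² = 0`, that determines the extension of `δ` to `U(L)`. -/
noncomputable def derAux (δ : LieDerivation K L L) : U →ₐ[K] TrivSqZeroExt U U :=
  UniversalEnvelopingAlgebra.lift K
    { toFun := fun l => TrivSqZeroExt.inl (UniversalEnvelopingAlgebra.ι K l)
        + TrivSqZeroExt.inr (UniversalEnvelopingAlgebra.ι K (δ l))
      map_add' := fun a b => by
        ext <;> simp
      map_smul' := fun c a => by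
        ext <;> simp
      map_lie' := fun {a b} => by
        ext
        · simp [LieRing.of_associative_ring_bracket, -UniversalEnvelopingAlgebra.ι_apply]
        · simp [LieRing.of_associative_ring_bracket, -UniversalEnvelopingAlgebra.ι_apply]
          abel }

/-- The extension of a derivation `δ` of `L` to a derivation of `U(L)`. -/
noncomputable def derU (δ : LieDerivation K L L) : U →ₗ[K] U :=
  ((TrivSqZeroExt.sndHom U U).restrictScalars K).comp (derAux δ).toLinearMap

theorem derAux_fst (δ : LieDerivation K L L) (x : U) : (derAux δ x).fst = x := by
  have h : (TrivSqZeroExt.fstHom K U U).comp (derAux δ) = AlgHom.id K U := by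
    apply UniversalEnvelopingAlgebra.hom_ext
    ext l
    simp [derAux, -UniversalEnvelopingAlgebra.ι_apply, UniversalEnvelopingAlgebra.lift_ι_apply]
  exact DFunLike.congr_fun h x

theorem derU_ι (δ : LieDerivation K L L) (l : L) :
    derU δ (UniversalEnvelopingAlgebra.ι K l) = UniversalEnvelopingAlgebra.ι K (δ l) := by
  simp [derU, derAux, -UniversalEnvelopingAlgebra.ι_apply,
    UniversalEnvelopingAlgebra.lift_ι_apply]

theorem derU_mul (δ : LieDerivation K L L) (x y : U) :
    derU δ (x * y) = derU δ x * y + x * derU δ y := by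
  have h : ∀ z, derU δ z = (derAux δ z).snd := fun _ => rfl
  simp only [h, map_mul, TrivSqZeroExt.snd_mul, derAux_fst, smul_eq_mul,
    MulOpposite.smul_eq_mul_unop, MulOpposite.unop_op]
  abel

/-- The logarithmic derivative `D_δ = S ∗ δ` on `U(L)`. -/
noncomputable def logDer (δ : LieDerivation K L L) : U →ₗ[K] U :=
  convolution K L (antipode K L) (derU δ)

theorem comul_ι (l : L) : comul K L (UniversalEnvelopingAlgebra.ι K l)
    = UniversalEnvelopingAlgebra.ι K l ⊗ₜ[K] 1 + 1 ⊗ₜ[K] UniversalEnvelopingAlgebra.ι K l := by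
  rw [comul, UniversalEnvelopingAlgebra.lift_ι_apply]; rfl

theorem antipode_ι (l : L) : antipode K L (UniversalEnvelopingAlgebra.ι K l)
    = -UniversalEnvelopingAlgebra.ι K l := by
  simp only [antipode, antipodeOp, LinearMap.comp_apply, AlgHom.toLinearMap_apply,
    UniversalEnvelopingAlgebra.lift_ι_apply]
  rfl

theorem antipode_mul (x y : U) :
    antipode K L (x * y) = antipode K L y * antipode K L x := by
  simp [antipode]

theorem antipode_one : antipode K L 1 = 1 := by
  simp [antipode]

end Enveloping

/-! ### Gradings and completions -/

section Graded

variable {K : Type*} [Field K] {L : Type*} [LieRing L] [LieAlgebra K L]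

local notation "U" => UniversalEnvelopingAlgebra K L

variable (ℒ : ℕ → Submodule K L)

/-- The degree `n` component `U(L)_n`: the span of the products `l₁ ⋯ l_k` (`k ≥ 0`) of
homogeneous elements of `L` whose degrees add up to `n`. -/
def gradedU (n : ℕ) : Submodule K U :=
  Submodule.span K {x | ∃ s : List (Σ i, ℒ i), (s.map Sigma.fst).sum = n ∧
    x = (s.map fun p => UniversalEnvelopingAlgebra.ι K (p.2 : L)).prod}

theorem one_mem_gradedU : (1 : U) ∈ gradedU ℒ 0 :=
  Submodule.subset_span ⟨[], rfl, rfl⟩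

theorem mul_mem_gradedU {m n : ℕ} {x y : U} (hx : x ∈ gradedU ℒ m) (hy : y ∈ gradedU ℒ n) :
    x * y ∈ gradedU ℒ (m + n) := by
  induction hx using Submodule.span_induction with
  | zero => rw [zero_mul]; exact zero_mem _
  | add a b _ _ ha hb => rw [add_mul]; exact add_mem ha hb
  | smul c a _ ha => rw [smul_mul_assoc]; exact Submodule.smul_mem _ _ ha
  | mem a ha =>
    obtain ⟨s, hs, rfl⟩ := ha
    induction hy using Submodule.span_induction with
    | zero => rw [mul_zero]; exact zero_mem _
    | add a b _ _ ha hb => rw [mul_add]; exact add_mem ha hb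
    | smul c a _ ha => rw [mul_smul_comm]; exact Submodule.smul_mem _ _ ha
    | mem b hb =>
      obtain ⟨t, ht, rfl⟩ := hb
      exact Submodule.subset_span ⟨s ++ t, by simp [hs, ht], by
        rw [List.map_append, List.prod_append]⟩

theorem ι_mem_gradedU {n : ℕ} {l : L} (hl : l ∈ ℒ n) :
    UniversalEnvelopingAlgebra.ι K l ∈ gradedU ℒ n :=
  Submodule.subset_span ⟨[⟨n, l, hl⟩], by simp, by simp⟩

/-- The completion `Û(L) = ∏ₙ U(L)_n`, with the Cauchy product.  The family `(xₙ)` is written as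
the series `∑ xₙ Tⁿ` in a bookkeeping variable `T`. -/
noncomputable def completedU : Subalgebra K U⟦X⟧ where
  carrier := {x | ∀ n, PowerSeries.coeff n x ∈ gradedU ℒ n}
  add_mem' := fun {x y} hx hy n => by rw [map_add]; exact add_mem (hx n) (hy n)
  mul_mem' := fun {x y} hx hy n => by
    rw [PowerSeries.coeff_mul]
    refine sum_mem fun p hp => ?_
    rw [← Finset.HasAntidiagonal.mem_antidiagonal.mp hp]
    exact mul_mem_gradedU ℒ (hx _) (hy _)
  algebraMap_mem' := fun c n => by
    rw [PowerSeries.algebraMap_apply, PowerSeries.coeff_C]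
    split_ifs with h
    · rw [h, Algebra.algebraMap_eq_smul_one]
      exact Submodule.smul_mem _ _ (one_mem_gradedU ℒ)
    · exact zero_mem _

/-- The extension to `Û(L)` of an endomorphism of `U(L)` that preserves the grading. -/
noncomputable def extendU (f : U →ₗ[K] U) (hf : ∀ n, ∀ x ∈ gradedU ℒ n, f x ∈ gradedU ℒ n) :
    completedU ℒ →ₗ[K] completedU ℒ where
  toFun x := ⟨PowerSeries.mk fun n => f (PowerSeries.coeff n x.1), fun n => by
    rw [PowerSeries.coeff_mk]; exact hf n _ (x.2 n)⟩
  map_add' x y := Subtype.ext <| PowerSeries.ext fun n => by simp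
  map_smul' c x := Subtype.ext <| PowerSeries.ext fun n => by simp

/-- The completion `L̂ = ∏ₙ L_n`. -/
abbrev completedL : Type _ := (n : ℕ) → ℒ n

/-- The canonical map `L̂ → Û(L)`. -/
noncomputable def ofL (l : completedL ℒ) : completedU ℒ :=
  ⟨PowerSeries.mk fun n => UniversalEnvelopingAlgebra.ι K (l n : L), fun n => by
    rw [PowerSeries.coeff_mk]; exact ι_mem_gradedU ℒ (l n).2⟩

/-- The exponential `exp l = ∑ₖ lᵏ / k! ∈ Û(L)` of `l ∈ L̂`. -/
noncomputable def expL (l : completedL ℒ) : completedU ℒ :=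
  ⟨formalExp K (ofL ℒ l).1, fun n => by
    rw [formalExp, PowerSeries.coeff_mk]
    exact sum_mem fun k _ => Submodule.smul_mem _ _ (((ofL ℒ l) ^ k).2 n)⟩

/-- The adjoint action on `L̂`: `(ad_l x)_n = ∑_{i+j=n} [l_i, x_j]`. -/
noncomputable def adL [GradedLieAlgebra ℒ] (l : completedL ℒ) : Module.End K (completedL ℒ) where
  toFun x := fun n => ⟨∑ p ∈ Finset.HasAntidiagonal.antidiagonal n, ⁅(l p.1 : L), (x p.2 : L)⁆,
    sum_mem fun p hp => by
      rw [← Finset.HasAntidiagonal.mem_antidiagonal.mp hp]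
      exact SetLike.GradedBracket.bracket_mem (l p.1).2 (x p.2).2⟩
  map_add' x y := by
    funext n
    ext
    simp [Finset.sum_add_distrib]
  map_smul' c x := by
    funext n
    ext
    simp [Finset.smul_sum]

/-- `(c(ad_l))(x) = ∑ᵢ cᵢ ad_lⁱ(x) ∈ L̂` for a power series `c`; since `l` has positive degree, in
degree `n` only the terms with `i ≤ n` can be nonzero. -/
noncomputable def applyAd [GradedLieAlgebra ℒ] (c : K⟦X⟧) (l x : completedL ℒ) : completedL ℒ :=
  fun n => ∑ i ∈ Finset.range (n + 1), PowerSeries.coeff i c • ((adL ℒ l) ^ i) x n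

/-- A graded Lie derivation: a derivation of the Lie algebra `L` with `δ(L_n) ⊆ L_n`. -/
structure GradedLieDerivation extends LieDerivation K L L where
  map_mem : ∀ n, ∀ x ∈ ℒ n, toFun x ∈ ℒ n

variable {ℒ} (δ : GradedLieDerivation ℒ)

/-- The extension of `δ` to `L̂`, degree by degree. -/
def GradedLieDerivation.onL (x : completedL ℒ) : completedL ℒ :=
  fun n => ⟨δ.toLieDerivation (x n), δ.map_mem n _ (x n).2⟩

theorem derU_mem (n : ℕ) (x : U) (hx : x ∈ gradedU ℒ n) :
    derU δ.toLieDerivation x ∈ gradedU ℒ n := by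
  induction hx using Submodule.span_induction with
  | zero => rw [map_zero]; exact zero_mem _
  | add a b _ _ ha hb => rw [map_add]; exact add_mem ha hb
  | smul c a _ ha => rw [map_smul]; exact Submodule.smul_mem _ _ ha
  | mem a ha =>
    obtain ⟨s, hs, rfl⟩ := ha
    induction s generalizing n with
    | nil =>
      have h1 : derU δ.toLieDerivation (1 : U) = 0 := by
        have := derU_mul δ.toLieDerivation (1 : U) 1
        simpa using this
      rw [List.map_nil, List.prod_nil, h1]
      exact zero_mem _
    | cons p s ih =>
      rw [List.map_cons, List.prod_cons, derU_mul, derU_ι, ← hs, List.map_cons, List.sum_cons]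
      exact add_mem
        (mul_mem_gradedU ℒ (ι_mem_gradedU ℒ (δ.map_mem _ _ p.2.2))
          (Submodule.subset_span ⟨s, rfl, rfl⟩))
        (mul_mem_gradedU ℒ (ι_mem_gradedU ℒ p.2.2) (ih _ rfl))

theorem antipode_mem (n : ℕ) (x : U) (hx : x ∈ gradedU ℒ n) :
    antipode K L x ∈ gradedU ℒ n := by
  induction hx using Submodule.span_induction with
  | zero => rw [map_zero]; exact zero_mem _
  | add a b _ _ ha hb => rw [map_add]; exact add_mem ha hb
  | smul c a _ ha => rw [map_smul]; exact Submodule.smul_mem _ _ ha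
  | mem a ha =>
    obtain ⟨s, hs, rfl⟩ := ha
    induction s generalizing n with
    | nil =>
      rw [List.map_nil, List.prod_nil, antipode_one, ← hs]
      exact one_mem_gradedU ℒ
    | cons p s ih =>
      rw [List.map_cons, List.prod_cons, antipode_mul, antipode_ι, ← hs, List.map_cons,
        List.sum_cons, add_comm]
      exact mul_mem_gradedU ℒ (ih _ rfl) (neg_mem (ι_mem_gradedU ℒ p.2.2))

theorem comul_mem (n : ℕ) (x : U) (hx : x ∈ gradedU ℒ n) :
    comul K L x ∈ Submodule.span K {z : U ⊗[K] U | ∃ i j, i + j = n ∧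
      ∃ a ∈ gradedU ℒ i, ∃ b ∈ gradedU ℒ j, z = a ⊗ₜ[K] b} := by
  induction hx using Submodule.span_induction with
  | zero => rw [map_zero]; exact zero_mem _
  | add a b _ _ ha hb => rw [map_add]; exact add_mem ha hb
  | smul c a _ ha => rw [map_smul]; exact Submodule.smul_mem _ _ ha
  | mem a ha =>
    obtain ⟨s, hs, rfl⟩ := ha
    induction s generalizing n with
    | nil =>
      rw [List.map_nil, List.prod_nil, map_one, ← hs]
      exact Submodule.subset_span
        ⟨0, 0, rfl, 1, one_mem_gradedU ℒ, 1, one_mem_gradedU ℒ, rfl⟩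
    | cons p s ih =>
      rw [List.map_cons, List.prod_cons, map_mul, comul_ι, ← hs, List.map_cons, List.sum_cons]
      have hp := ι_mem_gradedU ℒ p.2.2
      generalize comul K L (s.map fun p => UniversalEnvelopingAlgebra.ι K (p.2 : L)).prod = w at ih
      have hw := ih _ rfl
      clear ih
      induction hw using Submodule.span_induction with
      | zero => rw [mul_zero]; exact zero_mem _
      | add a b _ _ ha hb => rw [mul_add]; exact add_mem ha hb
      | smul c a _ ha => rw [mul_smul_comm]; exact Submodule.smul_mem _ _ ha
      | mem z hz =>
        obtain ⟨i, j, hij, a, ha, b, hb, rfl⟩ := hz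
        rw [add_mul, Algebra.TensorProduct.tmul_mul_tmul, Algebra.TensorProduct.tmul_mul_tmul,
          one_mul, one_mul]
        exact add_mem
          (Submodule.subset_span ⟨p.1 + i, j, by omega, _, mul_mem_gradedU ℒ hp ha, b, hb, rfl⟩)
          (Submodule.subset_span ⟨i, p.1 + j, by omega, a, ha, _, mul_mem_gradedU ℒ hp hb, rfl⟩)

theorem logDer_mem (n : ℕ) (x : U) (hx : x ∈ gradedU ℒ n) :
    logDer δ.toLieDerivation x ∈ gradedU ℒ n := by
  rw [logDer, convolution, LinearMap.comp_apply, LinearMap.comp_apply, AlgHom.toLinearMap_apply]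
  have hw := comul_mem n x hx
  generalize comul K L x = w at hw
  induction hw using Submodule.span_induction with
  | zero => rw [map_zero, map_zero]; exact zero_mem _
  | add a b _ _ ha hb => rw [map_add, map_add]; exact add_mem ha hb
  | smul c a _ ha => rw [map_smul, map_smul]; exact Submodule.smul_mem _ _ ha
  | mem z hz =>
    obtain ⟨i, j, hij, a, ha, b, hb, rfl⟩ := hz
    rw [TensorProduct.map_tmul, LinearMap.mul'_apply, ← hij]
    exact mul_mem_gradedU ℒ (antipode_mem i a ha) (derU_mem δ j b hb)

/-- The extension of the derivation `δ` to `Û(L)`. -/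
noncomputable def GradedLieDerivation.onU : completedU ℒ →ₗ[K] completedU ℒ :=
  extendU ℒ (derU δ.toLieDerivation) (derU_mem δ)

/-- The logarithmic derivative `D_δ = S ∗ δ`, extended to `Û(L)`. -/
noncomputable def GradedLieDerivation.logDerivative : completedU ℒ →ₗ[K] completedU ℒ :=
  extendU ℒ (logDer δ.toLieDerivation) (logDer_mem δ)

end Graded

end LogDer

namespace LogDer

/-! ### Two identities for finite sums over antidiagonals. -/

open Finset.HasAntidiagonal (antidiagonal mem_antidiagonal)

/-! Everything rests on one formula for the derivative of an exponential. If `x` is a series without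
constant term and `y` is its derivative, the derivative of `exp x` is `∑ₖ (∑_{i+j=k} xⁱ y xʲ) /
(k+1)!`. Left and right multiplication by `x` are commuting operators `A` and `B`, so this is `∑ₖ
(∑_{i+j=k} Aⁱ Bʲ) / (k+1)!` applied to `y`, which equals `exp(A) · (exp(B - A) - 1)/(B - A)`
(`coeff_formalApply_exp_expQuot`). Since `B - A = -ad_x`, the derivative is `exp x` times
`(exp(-ad_x) - 1)/(-ad_x)` applied to `y`; exchanging `A` and `B` puts `exp x` on the right and
`ad_x` in place of `-ad_x`.

For the Lie-algebra formula, `l` is primitive, so `exp l` is group-like (`map_comul_formalExp`).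
Hence `S ∗ δ` at `exp l` is the product `S(exp l) δ(exp l) = exp(-l) δ(exp l)`, and the derivative
formula cancels the exponentials. The map from the completed Lie algebra intertwines the two adjoint
actions (`ofL_adL`), so the result comes from that algebra.

For the classical formula, the coefficients of `Ω` are first shown to be differentiable by solving
`exp Ω = X` degree by degree. The same derivative formula then expresses `λA` through `Ω'`, and the
Bernoulli series inverts `(exp T - 1)/T` for `T = ∓ad_Ω`.

All operators involved raise degrees, so each coefficient of each operator series is a finite sum.
-/

/-- The antidiagonals with `s < N` tile the triangle `i + j < N` inside the square, and `f` vanishes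
on the rest of the square. -/
theorem sum_range_mul_range_eq_sum_antidiagonal {M : Type*} [AddCommMonoid M] (N : ℕ)
    (f : ℕ → ℕ → M) (hf : ∀ i j, N ≤ i + j → f i j = 0) :
    ∑ i ∈ Finset.range N, ∑ j ∈ Finset.range N, f i j
      = ∑ s ∈ Finset.range N, ∑ p ∈ antidiagonal s, f p.1 p.2 := by
  rw [← Finset.sum_product', Finset.sum_sigma']
  symm
  refine Finset.sum_of_injOn (fun x => x.2) ?_ ?_ ?_ ?_
  · rintro ⟨s, p⟩ h ⟨t, q⟩ h' e
    simp at h h' e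
    subst e
    obtain rfl : s = t := by omega
    rfl
  · rintro ⟨s, p⟩ h
    simp at h ⊢
    omega
  · rintro ⟨i, j⟩ h h'
    refine hf i j ?_
    by_contra hlt
    exact h' ⟨⟨i + j, (i, j)⟩, by simp; omega, rfl⟩
  · intros
    rfl

/-- Multiplied by `b - a`, both sides become `b ^ (k + 1) - a ^ (k + 1)`, but `b - a` need not be
cancellable. Instead, both sides satisfy the recursion `F (k + 1) = F k * b + a ^ (k + 1)`: the
right side directly, the left side by Pascal's rule. -/
theorem sum_choose_mul_pow_eq_geom_sum {R : Type*} [Ring R] {a b : R} (h : Commute a b) (k : ℕ) :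
    ∑ p ∈ antidiagonal k, ((k + 1).choose p.1 : R) * (a ^ p.1 * (b - a) ^ p.2)
      = ∑ p ∈ antidiagonal k, a ^ p.1 * b ^ p.2 := by
  have hz : Commute a (b - a) := h.sub_right (Commute.refl a)
  generalize hzd : b - a = z at hz
  obtain rfl : b = a + z := by rw [← hzd]; abel
  clear hzd
  induction k with
  | zero => simp
  | succ k ih =>
    have hG : ∑ p ∈ antidiagonal (k + 1), a ^ p.1 * (a + z) ^ p.2
        = (∑ p ∈ antidiagonal k, a ^ p.1 * (a + z) ^ p.2) * (a + z) + a ^ (k + 1) := by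
      rw [Finset.Nat.sum_antidiagonal_succ', Finset.sum_mul]
      simp [pow_succ, mul_assoc, add_comm]
    have hF : ∑ p ∈ antidiagonal (k + 1),
          ((k + 1 + 1).choose p.1 : R) * (a ^ p.1 * z ^ p.2)
        = (∑ p ∈ antidiagonal k, ((k + 1).choose p.1 : R) * (a ^ p.1 * z ^ p.2)) * z
          + (∑ p ∈ antidiagonal k, ((k + 1).choose p.1 : R) * (a ^ p.1 * z ^ p.2)) * a
          + a ^ (k + 1) := by
      have h1 : ∑ p ∈ antidiagonal (k + 1),
          ((k + 1 + 1).choose p.1 : R) * (a ^ p.1 * z ^ p.2)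
          = ∑ p ∈ antidiagonal (k + 1), ((k + 1).choose p.1 : R) * (a ^ p.1 * z ^ p.2)
            + ∑ p ∈ antidiagonal k,
              ((k + 1).choose p.1 : R) * (a ^ (p.1 + 1) * z ^ p.2) := by
        rw [Finset.Nat.sum_antidiagonal_succ, Finset.Nat.sum_antidiagonal_succ]
        simp only [Nat.choose_succ_succ (k + 1), Nat.cast_add, add_mul, Finset.sum_add_distrib]
        simp
        abel
      rw [h1, Finset.Nat.sum_antidiagonal_succ', Finset.sum_mul, Finset.sum_mul]
      have h2 : ∀ p : ℕ × ℕ, ((k + 1).choose p.1 : R) * (a ^ (p.1 + 1) * z ^ p.2)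
          = ((k + 1).choose p.1 : R) * (a ^ p.1 * z ^ p.2) * a := fun p => by
        rw [pow_succ, mul_assoc (a ^ p.1), (hz.pow_right p.2).eq]
        simp only [mul_assoc]
      simp only [h2, pow_succ z, mul_assoc]
      simp
      abel
    rw [hG, hF, ih, mul_add]
    abel

/-! ### Operator series in degree-raising operators, and the derivative of the formal exponential.
-/

section Operators

variable {K : Type*} [Field K] {R : Type*} [Ring R] [Algebra K R]

/-- `T` maps series of order at least `n` to series of order at least `n + 1`. -/
def RaisesDegree (T : Module.End K R⟦X⟧) : Prop :=
  ∀ (n : ℕ) (y : R⟦X⟧), (∀ m < n, PowerSeries.coeff m y = 0) →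
    ∀ m < n + 1, PowerSeries.coeff m (T y) = 0

theorem coeff_mul_eq_zero_of_lt {x y : R⟦X⟧} {a b n : ℕ}
    (hx : ∀ m < a, PowerSeries.coeff m x = 0) (hy : ∀ m < b, PowerSeries.coeff m y = 0)
    (hn : n < a + b) : PowerSeries.coeff n (x * y) = 0 := by
  rw [PowerSeries.coeff_mul]
  refine Finset.sum_eq_zero fun p hp => ?_
  have hp' := mem_antidiagonal.mp hp
  rcases lt_or_ge p.1 a with h | h
  · rw [hx _ h, zero_mul]
  · rw [hy _ (by omega), mul_zero]

theorem raisesDegree_mulLeft {x : R⟦X⟧} (hx : PowerSeries.coeff 0 x = 0) :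
    RaisesDegree (LinearMap.mulLeft K x) := fun n y hy m hm =>
  coeff_mul_eq_zero_of_lt (a := 1) (fun k hk => by rwa [Nat.lt_one_iff.mp hk]) hy (by omega)

theorem raisesDegree_mulRight {x : R⟦X⟧} (hx : PowerSeries.coeff 0 x = 0) :
    RaisesDegree (LinearMap.mulRight K x) := fun n y hy m hm =>
  coeff_mul_eq_zero_of_lt (b := 1) hy (fun k hk => by rwa [Nat.lt_one_iff.mp hk]) hm

namespace RaisesDegree

variable {S T : Module.End K R⟦X⟧}

theorem sub (hS : RaisesDegree S) (hT : RaisesDegree T) : RaisesDegree (S - T) :=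
  fun n y hy m hm => by
    rw [LinearMap.sub_apply, map_sub, hS n y hy m hm, hT n y hy m hm, sub_zero]

theorem pow_apply (hT : RaisesDegree T) (k : ℕ) {n : ℕ} {y : R⟦X⟧}
    (hy : ∀ m < n, PowerSeries.coeff m y = 0) :
    ∀ m < n + k, PowerSeries.coeff m ((T ^ k) y) = 0 := by
  induction k with
  | zero => simpa using hy
  | succ k ih =>
    rw [pow_succ', Module.End.mul_apply]
    exact hT _ _ ih

theorem coeff_pow_apply (hT : RaisesDegree T) {n k : ℕ} (h : n < k) (y : R⟦X⟧) :
    PowerSeries.coeff n ((T ^ k) y) = 0 :=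
  hT.pow_apply k (n := 0) (fun m hm => absurd hm (Nat.not_lt_zero m)) n (by omega)

/-- Powers of `T` see only the coefficients up to the degree being computed, so an argument may be
replaced by a truncation of it. -/
theorem coeff_pow_congr (hT : RaisesDegree T) (k : ℕ) {n : ℕ} {y z : R⟦X⟧}
    (h : ∀ m ≤ n, PowerSeries.coeff m y = PowerSeries.coeff m z) :
    PowerSeries.coeff n ((T ^ k) y) = PowerSeries.coeff n ((T ^ k) z) := by
  rw [← sub_eq_zero, ← map_sub, ← map_sub]
  refine hT.pow_apply k (n := n + 1) (fun m hm => ?_) n (by omega)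
  rw [map_sub, h m (by omega), sub_self]

/-- The definition truncates at a point depending on the degree; here a single `N` serves all
degrees below it, so that linearity can be used on a genuine finite sum. -/
theorem coeff_formalApply (hT : RaisesDegree T) (c : K⟦X⟧) (y : R⟦X⟧) {n N : ℕ} (h : n < N) :
    PowerSeries.coeff n (formalApply K c T y)
      = PowerSeries.coeff n
          (∑ k ∈ Finset.range N, PowerSeries.coeff k c • (T ^ k) y) := by
  rw [formalApply, PowerSeries.coeff_mk, map_sum]
  simp only [PowerSeries.coeff_smul]
  refine Finset.sum_subset (Finset.range_mono h) fun k _ hk => ?_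
  rw [hT.coeff_pow_apply (by simpa using hk), smul_zero]

/-- Two operator series applied one after the other, in each degree. -/
theorem coeff_formalApply_formalApply (hS : RaisesDegree S) (hT : RaisesDegree T) (c d : K⟦X⟧)
    (y : R⟦X⟧) (n : ℕ) :
    PowerSeries.coeff n (formalApply K c S (formalApply K d T y))
      = ∑ s ∈ Finset.range (n + 1), ∑ p ∈ antidiagonal s,
          (PowerSeries.coeff p.1 c * PowerSeries.coeff p.2 d) •
            PowerSeries.coeff n ((S ^ p.1) ((T ^ p.2) y)) := by
  rw [formalApply, PowerSeries.coeff_mk,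
    ← sum_range_mul_range_eq_sum_antidiagonal _ fun i j =>
      (PowerSeries.coeff i c * PowerSeries.coeff j d) •
        PowerSeries.coeff n ((S ^ i) ((T ^ j) y))]
  · refine Finset.sum_congr rfl fun k _ => ?_
    rw [hS.coeff_pow_congr k fun m hm => hT.coeff_formalApply d y (Nat.lt_succ_of_le hm),
      map_sum, map_sum, Finset.smul_sum]
    exact Finset.sum_congr rfl fun j _ => by
      rw [map_smul, PowerSeries.coeff_smul, smul_smul]
  · intro i j hij
    -- `T ^ j` produces order at least `j` and `S ^ i` adds at least `i`, which exceeds `n` in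
    -- total.
    rw [hS.pow_apply i (n := j), smul_zero]
    · exact fun m hm => hT.coeff_pow_apply hm y
    · omega

/-- Substituting `T` is multiplicative in the series, so an inverse pair of series gives inverse
operators. -/
theorem formalApply_mul (hT : RaisesDegree T) (c d : K⟦X⟧) (y : R⟦X⟧) :
    formalApply K (c * d) T y = formalApply K c T (formalApply K d T y) := by
  ext n
  rw [coeff_formalApply_formalApply hT hT, formalApply, PowerSeries.coeff_mk]
  refine Finset.sum_congr rfl fun s _ => ?_
  rw [PowerSeries.coeff_mul, Finset.sum_smul]
  refine Finset.sum_congr rfl fun p hp => ?_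
  rw [← Module.End.mul_apply, ← pow_add, mem_antidiagonal.mp hp]

end RaisesDegree

theorem formalApply_one (T : Module.End K R⟦X⟧) (y : R⟦X⟧) : formalApply K 1 T y = y := by
  ext n
  simp [formalApply, PowerSeries.coeff_one]

variable (K) in
/-- The power series `(exp x - 1) / x = ∑ᵢ xⁱ / (i+1)!`. -/
noncomputable def expQuot : K⟦X⟧ :=
  PowerSeries.mk fun i => ((i + 1).factorial : K)⁻¹

theorem X_mul_expQuot [CharZero K] : PowerSeries.X * expQuot K = PowerSeries.exp K - 1 := by
  ext n
  cases n with
  | zero => simp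
  | succ n =>
    rw [PowerSeries.coeff_succ_X_mul, map_sub, PowerSeries.coeff_one, PowerSeries.coeff_exp,
      expQuot, PowerSeries.coeff_mk, if_neg (Nat.succ_ne_zero n)]
    simp

theorem bernoulliSeries_mul_expQuot [CharZero K] : bernoulliSeries K * expQuot K = 1 := by
  have h := bernoulliSeries_mul_exp_sub_one K
  rw [← X_mul_expQuot, mul_left_comm] at h
  exact mul_left_cancel₀ PowerSeries.X_ne_zero (h.trans (mul_one _).symm)

/-- The signs `(-1) ^ k` are absorbed into `T`, so that one series `expQuot` serves both `ad` and
`-ad`. -/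
theorem formalApply_expNegQuot (T : Module.End K R⟦X⟧) (y : R⟦X⟧) :
    formalApply K (expNegQuot K) T y = formalApply K (expQuot K) (-T) y := by
  ext n
  simp only [formalApply, PowerSeries.coeff_mk, expNegQuot, expQuot]
  refine Finset.sum_congr rfl fun k _ => ?_
  rcases Nat.even_or_odd k with h | h <;> rw [h.neg_pow (1 : K), h.neg_pow T] <;> simp [neg_div]

/-- `exp(A) ((exp(B - A) - 1) / (B - A)) = ∑ₖ (∑_{i+j=k} Aⁱ Bʲ) / (k+1)!` for commuting `A`, `B`. -/
theorem coeff_formalApply_exp_expQuot [CharZero K] {A B : Module.End K R⟦X⟧}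
    (hA : RaisesDegree A) (hB : RaisesDegree B) (h : Commute A B) (y : R⟦X⟧) (n : ℕ) :
    PowerSeries.coeff n
        (formalApply K (PowerSeries.exp K) A (formalApply K (expQuot K) (B - A) y))
      = ∑ k ∈ Finset.range (n + 1), ((k + 1).factorial : K)⁻¹ •
          PowerSeries.coeff n (∑ p ∈ antidiagonal k, (A ^ p.1) ((B ^ p.2) y)) := by
  rw [RaisesDegree.coeff_formalApply_formalApply hA (hB.sub hA)]
  refine Finset.sum_congr rfl fun k _ => ?_
  have hk := congrArg (fun T : Module.End K R⟦X⟧ => T y) (sum_choose_mul_pow_eq_geom_sum h k)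
  simp only [LinearMap.sum_apply, Module.End.mul_apply] at hk
  rw [← hk, map_sum, Finset.smul_sum]
  refine Finset.sum_congr rfl fun p hp => ?_
  have hp' := mem_antidiagonal.mp hp
  -- With `i + j = k`, this is `1/i! · 1/(j+1)! = C(k+1, i)/(k+1)!`; the shift `j + 1` comes from
  -- the quotient series.
  have hc : PowerSeries.coeff p.1 (PowerSeries.exp K) * PowerSeries.coeff p.2 (expQuot K)
      = ((k + 1).factorial : K)⁻¹ * ((k + 1).choose p.1 : K) := by
    have h1 : k + 1 = p.1 + (p.2 + 1) := by omega
    rw [h1, Nat.cast_add_choose K, PowerSeries.coeff_exp, expQuot, PowerSeries.coeff_mk]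
    have h2 : ((p.1 + (p.2 + 1)).factorial : K) ≠ 0 := Nat.cast_ne_zero.mpr (Nat.factorial_ne_zero _)
    field_simp
    simp [div_eq_mul_inv]
  rw [hc, mul_smul, Module.End.natCast_apply, map_nsmul, Nat.cast_smul_eq_nsmul]

theorem formalExp_mul_eq_formalApply [CharZero K] {x : R⟦X⟧} (hx : PowerSeries.coeff 0 x = 0)
    (y : R⟦X⟧) :
    formalExp K x * y = formalApply K (PowerSeries.exp K) (LinearMap.mulLeft K x) y := by
  ext n
  rw [(raisesDegree_mulLeft hx).coeff_formalApply _ _ (Nat.lt_succ_self n)]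
  -- All coefficients of the exponential are padded to the same range, so that the sum over `k` can
  -- be pulled out of the Cauchy product.
  have h : ∀ p ∈ antidiagonal n, PowerSeries.coeff p.1 (formalExp K x)
      = PowerSeries.coeff p.1 (∑ k ∈ Finset.range (n + 1), (k.factorial : K)⁻¹ • x ^ k) := by
    intro p hp
    have hp' := mem_antidiagonal.mp hp
    rw [formalExp, PowerSeries.coeff_mk, map_sum]
    simp only [PowerSeries.coeff_smul]
    refine Finset.sum_subset (Finset.range_mono (by omega)) fun k _ hk => ?_
    rw [coeff_pow_of_lt x hx (by simpa using hk), smul_zero]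
  rw [PowerSeries.coeff_mul, Finset.sum_congr rfl fun p hp => by rw [h p hp],
    ← PowerSeries.coeff_mul, Finset.sum_mul]
  simp [PowerSeries.coeff_exp, LinearMap.pow_mulLeft]

theorem mul_formalExp_eq_formalApply [CharZero K] {x : R⟦X⟧} (hx : PowerSeries.coeff 0 x = 0)
    (y : R⟦X⟧) :
    y * formalExp K x = formalApply K (PowerSeries.exp K) (LinearMap.mulRight K x) y := by
  ext n
  rw [(raisesDegree_mulRight hx).coeff_formalApply _ _ (Nat.lt_succ_self n)]
  have h : ∀ p ∈ antidiagonal n, PowerSeries.coeff p.2 (formalExp K x)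
      = PowerSeries.coeff p.2 (∑ k ∈ Finset.range (n + 1), (k.factorial : K)⁻¹ • x ^ k) := by
    intro p hp
    have hp' := mem_antidiagonal.mp hp
    rw [formalExp, PowerSeries.coeff_mk, map_sum]
    simp only [PowerSeries.coeff_smul]
    refine Finset.sum_subset (Finset.range_mono (by omega)) fun k _ hk => ?_
    rw [coeff_pow_of_lt x hx (by simpa using hk), smul_zero]
  rw [PowerSeries.coeff_mul, Finset.sum_congr rfl fun p hp => by rw [h p hp],
    ← PowerSeries.coeff_mul, Finset.mul_sum]
  simp [PowerSeries.coeff_exp, LinearMap.pow_mulRight]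

/-- `∑_{i+j=k} xⁱ y xʲ`, the derivative of `x ^ (k + 1)` when `y` is the derivative of `x`. -/
noncomputable def derivPow (x y : R⟦X⟧) (k : ℕ) : R⟦X⟧ :=
  ∑ p ∈ antidiagonal k, x ^ p.1 * y * x ^ p.2

theorem derivPow_succ (x y : R⟦X⟧) (k : ℕ) :
    derivPow x y (k + 1) = derivPow x y k * x + x ^ (k + 1) * y := by
  rw [derivPow, Finset.Nat.sum_antidiagonal_succ', derivPow, Finset.sum_mul]
  simp [pow_succ, mul_assoc, add_comm]

theorem coeff_formalExp_mul_derivative [CharZero K] {x : R⟦X⟧} (hx : PowerSeries.coeff 0 x = 0)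
    (y : R⟦X⟧) (n : ℕ) :
    PowerSeries.coeff n (formalExp K x * formalApply K (expQuot K) (-formalAd K x) y)
      = ∑ k ∈ Finset.range (n + 1), ((k + 1).factorial : K)⁻¹ •
          PowerSeries.coeff n (derivPow x y k) := by
  have h := coeff_formalApply_exp_expQuot (raisesDegree_mulLeft (K := K) hx)
    (raisesDegree_mulRight hx) (LinearMap.commute_mulLeft_right x x) y n
  rw [formalExp_mul_eq_formalApply hx, formalAd, neg_sub, h]
  simp [derivPow, LinearMap.pow_mulLeft, LinearMap.pow_mulRight, mul_assoc]

/-- The roles of left and right multiplication are exchanged, which turns `-ad` into `ad`;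
`derivPow` is symmetric under reversing the antidiagonal. -/
theorem coeff_derivative_mul_formalExp [CharZero K] {x : R⟦X⟧} (hx : PowerSeries.coeff 0 x = 0)
    (y : R⟦X⟧) (n : ℕ) :
    PowerSeries.coeff n (formalApply K (expQuot K) (formalAd K x) y * formalExp K x)
      = ∑ k ∈ Finset.range (n + 1), ((k + 1).factorial : K)⁻¹ •
          PowerSeries.coeff n (derivPow x y k) := by
  have h := coeff_formalApply_exp_expQuot (raisesDegree_mulRight (K := K) hx)
    (raisesDegree_mulLeft hx) (LinearMap.commute_mulLeft_right x x).symm y n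
  rw [mul_formalExp_eq_formalApply hx, formalAd, h]
  refine Finset.sum_congr rfl fun k _ => ?_
  rw [derivPow, ← Finset.Nat.sum_antidiagonal_swap]
  simp [LinearMap.pow_mulLeft, LinearMap.pow_mulRight]

/-- Each of the `k + 1` factors has order at least one. This removes the top term `k = n` when sums
indexed by `k` and by `k + 1` are compared. -/
theorem coeff_derivPow_eq_zero {x y : R⟦X⟧} (hx : PowerSeries.coeff 0 x = 0)
    (hy : PowerSeries.coeff 0 y = 0) {n k : ℕ} (h : n ≤ k) :
    PowerSeries.coeff n (derivPow x y k) = 0 := by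
  rw [derivPow, map_sum]
  refine Finset.sum_eq_zero fun p hp => ?_
  have hp' := mem_antidiagonal.mp hp
  refine coeff_mul_eq_zero_of_lt (a := p.1 + 1) (b := p.2) (fun m hm => ?_)
    (fun m hm => coeff_pow_of_lt x hx hm) (by omega)
  exact coeff_mul_eq_zero_of_lt (a := p.1) (b := 1) (fun m hm => coeff_pow_of_lt x hx hm)
    (fun m hm => by rwa [Nat.lt_one_iff.mp hm]) hm

theorem formalExp_add [CharZero K] {x y : R⟦X⟧} (hx : PowerSeries.coeff 0 x = 0)
    (hy : PowerSeries.coeff 0 y = 0) (h : Commute x y) :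
    formalExp K (x + y) = formalExp K x * formalExp K y := by
  ext n
  -- Both exponentials act as operator series on `1`, which reduces the claim to the binomial
  -- theorem in each total degree.
  rw [← mul_one (formalExp K y), formalExp_mul_eq_formalApply hx, formalExp_mul_eq_formalApply hy,
    (raisesDegree_mulLeft hx).coeff_formalApply_formalApply (raisesDegree_mulLeft hy), formalExp,
    PowerSeries.coeff_mk]
  refine Finset.sum_congr rfl fun k _ => ?_
  rw [h.add_pow', map_sum, Finset.smul_sum]
  refine Finset.sum_congr rfl fun p hp => ?_
  have hp' := mem_antidiagonal.mp hp
  have hc : (k.factorial : K)⁻¹ * (k.choose p.1 : K)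
      = PowerSeries.coeff p.1 (PowerSeries.exp K) * PowerSeries.coeff p.2 (PowerSeries.exp K) := by
    rw [← hp', Nat.cast_add_choose K, PowerSeries.coeff_exp, PowerSeries.coeff_exp]
    have h2 : ((p.1 + p.2).factorial : K) ≠ 0 := Nat.cast_ne_zero.mpr (Nat.factorial_ne_zero _)
    field_simp
    simp [mul_comm]
  rw [← hc, mul_smul, map_nsmul, Nat.cast_smul_eq_nsmul, LinearMap.pow_mulLeft,
    LinearMap.pow_mulLeft, LinearMap.mulLeft_apply, LinearMap.mulLeft_apply, mul_one]

theorem formalExp_zero : formalExp K (0 : R⟦X⟧) = 1 := by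
  ext n
  rw [formalExp, PowerSeries.coeff_mk, Finset.sum_range_succ']
  simp

theorem formalExp_neg_mul_formalExp [CharZero K] {x : R⟦X⟧} (hx : PowerSeries.coeff 0 x = 0) :
    formalExp K (-x) * formalExp K x = 1 := by
  rw [← formalExp_add (by rw [map_neg, hx, neg_zero]) hx (Commute.refl x).neg_left, neg_add_cancel, formalExp_zero]

theorem formalExp_mul_formalExp_neg [CharZero K] {x : R⟦X⟧} (hx : PowerSeries.coeff 0 x = 0) :
    formalExp K x * formalExp K (-x) = 1 := by
  rw [← formalExp_add hx (by rw [map_neg, hx, neg_zero]) (Commute.refl x).neg_right, add_neg_cancel, formalExp_zero]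

theorem map_formalExp {R' : Type*} [Ring R'] [Algebra K R'] (f : R →ₐ[K] R') (x : R⟦X⟧) :
    PowerSeries.map (f : R →+* R') (formalExp K x)
      = formalExp K (PowerSeries.map (f : R →+* R') x) := by
  ext n
  simp [formalExp, ← map_pow]

end Operators

/-! ### Antipode, derivation and coproduct on exponentials; the formula in the completed enveloping
algebra. -/

section Completed

variable {K : Type*} [Field K]

/-- The coefficientwise extension of a linear map to power series. -/
noncomputable def mapCoeff {R : Type*} [Ring R] [Algebra K R] {M : Type*} [Ring M] [Algebra K M]
    (f : R →ₗ[K] M) : R⟦X⟧ →ₗ[K] M⟦X⟧ where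
  toFun x := PowerSeries.mk fun n => f (PowerSeries.coeff n x)
  map_add' x y := PowerSeries.ext fun n => by simp
  map_smul' c x := PowerSeries.ext fun n => by simp

theorem coeff_mapCoeff {R : Type*} [Ring R] [Algebra K R] {M : Type*} [Ring M] [Algebra K M]
    (f : R →ₗ[K] M) (x : R⟦X⟧) (n : ℕ) :
    PowerSeries.coeff n (mapCoeff f x) = f (PowerSeries.coeff n x) := by
  simp [mapCoeff]

theorem mapCoeff_formalExp {R : Type*} [Ring R] [Algebra K R] (f : R →ₗ[K] R) (x : R⟦X⟧) (n : ℕ) :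
    PowerSeries.coeff n (mapCoeff f (formalExp K x))
      = ∑ k ∈ Finset.range (n + 1),
          (k.factorial : K)⁻¹ • PowerSeries.coeff n (mapCoeff f (x ^ k)) := by
  simp [coeff_mapCoeff, formalExp]

variable {L : Type*} [LieRing L] [LieAlgebra K L]

local notation "U" => UniversalEnvelopingAlgebra K L

theorem mapCoeff_antipode_mul (x y : U⟦X⟧) :
    mapCoeff (antipode K L) (x * y)
      = mapCoeff (antipode K L) y * mapCoeff (antipode K L) x := by
  ext n
  rw [coeff_mapCoeff, PowerSeries.coeff_mul, PowerSeries.coeff_mul, map_sum,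
    ← Finset.Nat.sum_antidiagonal_swap]
  simp [coeff_mapCoeff, antipode_mul]

theorem mapCoeff_antipode_one : mapCoeff (antipode K L) 1 = 1 := by
  ext n
  rw [coeff_mapCoeff, PowerSeries.coeff_one]
  split_ifs <;> simp [antipode_one]

/-- The antipode reverses products, but in a power all factors agree, so it sends `x ^ k` to `(-x) ^
k`. -/
theorem mapCoeff_antipode_formalExp {x : U⟦X⟧} (hx : mapCoeff (antipode K L) x = -x) :
    mapCoeff (antipode K L) (formalExp K x) = formalExp K (-x) := by
  have h : ∀ k : ℕ, mapCoeff (antipode K L) (x ^ k) = (-x) ^ k := by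
    intro k
    induction k with
    | zero => rw [pow_zero, pow_zero, mapCoeff_antipode_one]
    | succ k ih => rw [pow_succ, mapCoeff_antipode_mul, ih, hx, pow_succ']
  ext n
  rw [mapCoeff_formalExp, formalExp, PowerSeries.coeff_mk]
  simp only [h]

theorem mapCoeff_derU_mul (δ : LieDerivation K L L) (x y : U⟦X⟧) :
    mapCoeff (derU δ) (x * y) = mapCoeff (derU δ) x * y + x * mapCoeff (derU δ) y := by
  ext n
  rw [coeff_mapCoeff, PowerSeries.coeff_mul, map_add, PowerSeries.coeff_mul,
    PowerSeries.coeff_mul, map_sum]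
  simp [coeff_mapCoeff, derU_mul, Finset.sum_add_distrib]

theorem mapCoeff_derU_pow_succ (δ : LieDerivation K L L) (x : U⟦X⟧) (k : ℕ) :
    mapCoeff (derU δ) (x ^ (k + 1)) = derivPow x (mapCoeff (derU δ) x) k := by
  induction k with
  | zero => simp [derivPow]
  | succ k ih => rw [pow_succ, mapCoeff_derU_mul, ih, derivPow_succ]

theorem mapCoeff_derU_formalExp [CharZero K] (δ : LieDerivation K L L) {x : U⟦X⟧}
    (hx : PowerSeries.coeff 0 x = 0) :
    mapCoeff (derU δ) (formalExp K x) = formalExp K x *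
      formalApply K (expNegQuot K) (formalAd K x) (mapCoeff (derU δ) x) := by
  have h1 : mapCoeff (derU δ) (1 : U⟦X⟧) = 0 := by
    simpa using mapCoeff_derU_mul δ (1 : U⟦X⟧) 1
  ext n
  -- The term of degree zero in the exponential is killed by the derivation, and the top term on the
  -- other side has too high an order; the remaining sums match after a shift by one.
  rw [mapCoeff_formalExp, formalApply_expNegQuot, coeff_formalExp_mul_derivative hx,
    Finset.sum_range_succ', Finset.sum_range_succ, coeff_derivPow_eq_zero hx _ le_rfl]
  · simp [h1, mapCoeff_derU_pow_succ]
  · rw [coeff_mapCoeff, hx, map_zero]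

/-- Exponentials of primitive elements are group-like: `x ⊗ 1` and `1 ⊗ x` commute, so the
exponential of their sum factors, and algebra maps commute with `formalExp`. -/
theorem map_comul_formalExp [CharZero K] {x : U⟦X⟧} (hx : PowerSeries.coeff 0 x = 0)
    (hΔ : ∀ n, comul K L (PowerSeries.coeff n x)
      = PowerSeries.coeff n x ⊗ₜ[K] 1 + 1 ⊗ₜ[K] PowerSeries.coeff n x) (n : ℕ) :
    comul K L (PowerSeries.coeff n (formalExp K x))
      = ∑ p ∈ antidiagonal n, PowerSeries.coeff p.1 (formalExp K x) ⊗ₜ[K]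
          PowerSeries.coeff p.2 (formalExp K x) := by
  set iL : U →ₐ[K] U ⊗[K] U := Algebra.TensorProduct.includeLeft
  set iR : U →ₐ[K] U ⊗[K] U := Algebra.TensorProduct.includeRight
  have hx' : PowerSeries.map (comul K L : U →+* U ⊗[K] U) x
      = PowerSeries.map (iL : U →+* U ⊗[K] U) x + PowerSeries.map (iR : U →+* U ⊗[K] U) x := by
    ext n
    simp [hΔ, iL, iR]
  have hc : Commute (PowerSeries.map (iL : U →+* U ⊗[K] U) x)
      (PowerSeries.map (iR : U →+* U ⊗[K] U) x) := by
    ext n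
    rw [PowerSeries.coeff_mul, PowerSeries.coeff_mul, ← Finset.Nat.sum_antidiagonal_swap]
    simp [iL, iR]
  have h0 : ∀ f : U →ₐ[K] U ⊗[K] U,
      PowerSeries.coeff 0 (PowerSeries.map (f : U →+* U ⊗[K] U) x) = 0 := fun f => by
    rw [PowerSeries.coeff_map, hx, map_zero]
  have h := congrArg (PowerSeries.coeff n) (map_formalExp (K := K) (comul K L) x)
  rw [hx', formalExp_add (h0 _) (h0 _) hc, ← map_formalExp, ← map_formalExp,
    PowerSeries.coeff_mul] at h
  simpa [iL, iR] using h

/-- On a group-like element a convolution is the product of the two values. -/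
theorem mapCoeff_logDer_formalExp [CharZero K] (δ : LieDerivation K L L) {x : U⟦X⟧}
    (hx : PowerSeries.coeff 0 x = 0)
    (hΔ : ∀ n, comul K L (PowerSeries.coeff n x)
      = PowerSeries.coeff n x ⊗ₜ[K] 1 + 1 ⊗ₜ[K] PowerSeries.coeff n x)
    (hS : mapCoeff (antipode K L) x = -x) :
    mapCoeff (logDer δ) (formalExp K x)
      = formalExp K (-x) * mapCoeff (derU δ) (formalExp K x) := by
  ext n
  rw [coeff_mapCoeff, logDer, convolution, LinearMap.comp_apply, LinearMap.comp_apply,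
    AlgHom.toLinearMap_apply, map_comul_formalExp hx hΔ, ← mapCoeff_antipode_formalExp hS,
    PowerSeries.coeff_mul, map_sum, map_sum]
  simp [coeff_mapCoeff]

variable (ℒ : ℕ → Submodule K L)

theorem coeff_ofL (l : completedL ℒ) (n : ℕ) :
    PowerSeries.coeff n (ofL ℒ l).1 = UniversalEnvelopingAlgebra.ι K (l n : L) := by
  rw [ofL, PowerSeries.coeff_mk]

theorem coeff_zero_ofL (hpos : ℒ 0 = ⊥) (l : completedL ℒ) :
    PowerSeries.coeff 0 (ofL ℒ l).1 = 0 := by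
  have h : (l 0 : L) = 0 := (Submodule.mem_bot K).mp (hpos.le (l 0).2)
  rw [coeff_ofL, h, map_zero]

theorem ofL_neg (l : completedL ℒ) : (ofL ℒ (-l)).1 = -(ofL ℒ l).1 := by
  ext n
  simp [coeff_ofL, -UniversalEnvelopingAlgebra.ι_apply]

theorem logDerivative_expL [CharZero K] (hpos : ℒ 0 = ⊥) (δ : GradedLieDerivation ℒ)
    (l : completedL ℒ) :
    δ.logDerivative (expL ℒ l) = expL ℒ (-l) * δ.onU (expL ℒ l) := by
  have h0 := coeff_zero_ofL ℒ hpos l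
  have h := mapCoeff_logDer_formalExp δ.toLieDerivation h0
    (fun n => by rw [coeff_ofL, comul_ι]) (by
      ext n
      rw [coeff_mapCoeff, coeff_ofL, antipode_ι, map_neg, coeff_ofL])
  rw [← ofL_neg] at h
  exact Subtype.ext h

variable [GradedLieAlgebra ℒ]

/-- Brackets become commutators in the enveloping algebra; one of the two Cauchy products is
reindexed by the swap. -/
theorem ofL_adL (l x : completedL ℒ) :
    (ofL ℒ (adL ℒ l x)).1 = formalAd K (ofL ℒ l).1 (ofL ℒ x).1 := by
  ext n
  rw [coeff_ofL, formalAd, LinearMap.sub_apply, LinearMap.mulLeft_apply, LinearMap.mulRight_apply,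
    map_sub, PowerSeries.coeff_mul, PowerSeries.coeff_mul,
    ← Finset.Nat.sum_antidiagonal_swap (f := fun p : ℕ × ℕ =>
      PowerSeries.coeff p.1 (ofL ℒ x).1 * PowerSeries.coeff p.2 (ofL ℒ l).1),
    ← Finset.sum_sub_distrib]
  simp only [adL, LinearMap.coe_mk, AddHom.coe_mk, map_sum, LieHom.map_lie, coeff_ofL,
    LieRing.of_associative_ring_bracket, Prod.fst_swap, Prod.snd_swap]

theorem ofL_adL_pow (l x : completedL ℒ) (k : ℕ) :
    (ofL ℒ ((adL ℒ l ^ k) x)).1 = (formalAd K (ofL ℒ l).1 ^ k) (ofL ℒ x).1 := by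
  induction k with
  | zero => simp
  | succ k ih =>
    rw [pow_succ', Module.End.mul_apply, ofL_adL, ih, pow_succ', Module.End.mul_apply]

theorem ofL_applyAd (c : K⟦X⟧) (l x : completedL ℒ) :
    (ofL ℒ (applyAd ℒ c l x)).1 = formalApply K c (formalAd K (ofL ℒ l).1) (ofL ℒ x).1 := by
  ext n
  simp only [coeff_ofL, applyAd, formalApply, PowerSeries.coeff_mk, ← ofL_adL_pow,
    Submodule.coe_sum, Submodule.coe_smul, map_sum, map_smul]

variable {ℒ}

theorem expL_neg_mul_onU_expL [CharZero K] (hpos : ℒ 0 = ⊥) (δ : GradedLieDerivation ℒ)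
    (l : completedL ℒ) :
    expL ℒ (-l) * δ.onU (expL ℒ l) = ofL ℒ (applyAd ℒ (expNegQuot K) l (δ.onL l)) := by
  have h0 := coeff_zero_ofL ℒ hpos l
  have hδ : mapCoeff (derU δ.toLieDerivation) (ofL ℒ l).1 = (ofL ℒ (δ.onL l)).1 := by
    ext n
    rw [coeff_mapCoeff, coeff_ofL, coeff_ofL, derU_ι]
    rfl
  apply Subtype.ext
  calc (expL ℒ (-l) * δ.onU (expL ℒ l)).1
      = formalExp K (ofL ℒ (-l)).1 * mapCoeff (derU δ.toLieDerivation)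
          (formalExp K (ofL ℒ l).1) := rfl
    _ = _ := by
      rw [mapCoeff_derU_formalExp _ h0, ofL_neg, ← mul_assoc, formalExp_neg_mul_formalExp h0,
        one_mul, hδ, ofL_applyAd]

end Completed

/-! ### Coefficientwise differentiation and the classical Magnus formula. -/

section Magnus

variable {𝔸 : Type*} [NormedRing 𝔸] [NormedAlgebra ℝ 𝔸]

/-- Without constant terms, degree `n` of a product involves only coefficients of degree strictly
below `n` of each factor. -/
theorem differentiable_coeff_mul {F G : ℝ → 𝔸⟦X⟧} {n : ℕ}
    (hF0 : ∀ t, PowerSeries.coeff 0 (F t) = 0) (hG0 : ∀ t, PowerSeries.coeff 0 (G t) = 0)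
    (hF : ∀ m < n, Differentiable ℝ fun t => PowerSeries.coeff m (F t))
    (hG : ∀ m < n, Differentiable ℝ fun t => PowerSeries.coeff m (G t)) :
    Differentiable ℝ fun t => PowerSeries.coeff n (F t * G t) := by
  simp only [PowerSeries.coeff_mul]
  refine Differentiable.fun_sum fun p hp => ?_
  have hp' := mem_antidiagonal.mp hp
  rcases Nat.eq_zero_or_pos p.1 with h1 | h1
  · simp only [h1, hF0, zero_mul]
    exact differentiable_const _
  rcases Nat.eq_zero_or_pos p.2 with h2 | h2
  · simp only [h2, hG0, mul_zero]
    exact differentiable_const _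
  exact (hF _ (by omega)).mul (hG _ (by omega))

theorem differentiable_coeff_pow {Ω : ℝ → 𝔸⟦X⟧} {n : ℕ}
    (h0 : ∀ t, PowerSeries.coeff 0 (Ω t) = 0)
    (h : ∀ m < n, Differentiable ℝ fun t => PowerSeries.coeff m (Ω t)) (k : ℕ) :
    ∀ m < n + 1, Differentiable ℝ fun t => PowerSeries.coeff m (Ω t ^ (k + 2)) := by
  induction k with
  | zero =>
    intro m hm
    simp only [zero_add, pow_two]
    exact differentiable_coeff_mul h0 h0 (fun j hj => h j (by omega)) fun j hj => h j (by omega)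
  | succ k ih =>
    intro m hm
    simp only [pow_succ _ (k + 2)]
    exact differentiable_coeff_mul (fun t => coeff_pow_of_lt _ (h0 t) (by omega)) h0
      (fun j hj => ih j (by omega)) fun j hj => h j (by omega)

/-- The top coefficient of `Ω` enters `exp Ω` only through the linear term; powers `Ω ^ (k + 2)`
involve lower coefficients. Solving for it gives a strong induction on the degree. -/
theorem differentiable_coeff_of_formalExp {Ω : ℝ → 𝔸⟦X⟧}
    (h0 : ∀ t, PowerSeries.coeff 0 (Ω t) = 0)
    (hY : ∀ n, Differentiable ℝ fun t => PowerSeries.coeff n (formalExp ℝ (Ω t))) (n : ℕ) :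
    Differentiable ℝ fun t => PowerSeries.coeff n (Ω t) := by
  induction n using Nat.strong_induction_on with
  | _ n ih =>
    cases n with
    | zero =>
      simp only [h0]
      exact differentiable_const _
    | succ n =>
      have h : (fun t => PowerSeries.coeff (n + 1) (Ω t)) = fun t =>
          PowerSeries.coeff (n + 1) (formalExp ℝ (Ω t))
            - ∑ k ∈ Finset.range n, ((k + 2).factorial : ℝ)⁻¹ •
                PowerSeries.coeff (n + 1) (Ω t ^ (k + 2)) := by
        funext t
        rw [formalExp, PowerSeries.coeff_mk, Finset.sum_range_succ', Finset.sum_range_succ']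
        simp [PowerSeries.coeff_one]
      rw [h]
      refine (hY _).sub (Differentiable.fun_sum fun k _ => Differentiable.fun_const_smul ?_ _)
      exact differentiable_coeff_pow h0 ih k _ (Nat.lt_succ_self _)

/-- `F` has coefficientwise derivative `F'` at `t`. -/
def HasCoeffDerivAt (F : ℝ → 𝔸⟦X⟧) (F' : 𝔸⟦X⟧) (t : ℝ) : Prop :=
  ∀ n, HasDerivAt (fun s => PowerSeries.coeff n (F s)) (PowerSeries.coeff n F') t

theorem HasCoeffDerivAt.unique {F : ℝ → 𝔸⟦X⟧} {F' F'' : 𝔸⟦X⟧} {t : ℝ}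
    (h : HasCoeffDerivAt F F' t) (h' : HasCoeffDerivAt F F'' t) : F' = F'' :=
  PowerSeries.ext fun n => (h n).unique (h' n)

theorem HasCoeffDerivAt.mul {F G : ℝ → 𝔸⟦X⟧} {F' G' : 𝔸⟦X⟧} {t : ℝ}
    (hF : HasCoeffDerivAt F F' t) (hG : HasCoeffDerivAt G G' t) :
    HasCoeffDerivAt (fun s => F s * G s) (F' * G t + F t * G') t := fun n => by
  rw [map_add, PowerSeries.coeff_mul, PowerSeries.coeff_mul, ← Finset.sum_add_distrib]
  simp only [PowerSeries.coeff_mul]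
  exact HasDerivAt.fun_sum fun p _ => (hF p.1).mul (hG p.2)

theorem HasCoeffDerivAt.pow_succ {F : ℝ → 𝔸⟦X⟧} {F' : 𝔸⟦X⟧} {t : ℝ}
    (hF : HasCoeffDerivAt F F' t) (k : ℕ) :
    HasCoeffDerivAt (fun s => F s ^ (k + 1)) (derivPow (F t) F' k) t := by
  induction k with
  | zero => simpa [derivPow] using hF
  | succ k ih =>
    simp only [_root_.pow_succ _ (k + 1)]
    rw [derivPow_succ]
    exact ih.mul hF

theorem HasCoeffDerivAt.coeff_formalExp {Ω : ℝ → 𝔸⟦X⟧} {Ω' : 𝔸⟦X⟧} {t : ℝ}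
    (h0 : ∀ t, PowerSeries.coeff 0 (Ω t) = 0) (h0' : PowerSeries.coeff 0 Ω' = 0)
    (hΩ : HasCoeffDerivAt Ω Ω' t) (n : ℕ) :
    HasDerivAt (fun s => PowerSeries.coeff n (formalExp ℝ (Ω s)))
      (∑ k ∈ Finset.range (n + 1), ((k + 1).factorial : ℝ)⁻¹ •
        PowerSeries.coeff n (derivPow (Ω t) Ω' k)) t := by
  simp only [formalExp, PowerSeries.coeff_mk]
  -- The extra term `k = n` is zero; without it the sum matches the termwise derivative of the
  -- powers `1, …, n`, the power `0` being constant.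
  rw [Finset.sum_range_succ, coeff_derivPow_eq_zero (h0 t) h0' le_rfl, smul_zero]
  simp only [Finset.sum_range_succ' _ n]
  refine HasDerivAt.add (HasDerivAt.fun_sum fun k _ => ?_) ?_
  · exact HasDerivAt.fun_const_smul _ (hΩ.pow_succ k n)
  · simp only [pow_zero]
    exact hasDerivAt_const _ _

/-- The same derivative of `exp Ω` is written with the exponential on the left and on the right, one
form for each of the two differential equations. -/
theorem exists_hasCoeffDerivAt_of_formalExp {Ω : ℝ → 𝔸⟦X⟧}
    (h0 : ∀ t, PowerSeries.coeff 0 (Ω t) = 0)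
    (hY : ∀ n, Differentiable ℝ fun t => PowerSeries.coeff n (formalExp ℝ (Ω t))) (t : ℝ) :
    ∃ Ω' : 𝔸⟦X⟧, HasCoeffDerivAt Ω Ω' t ∧
      HasCoeffDerivAt (fun s => formalExp ℝ (Ω s))
        (formalExp ℝ (Ω t) * formalApply ℝ (expQuot ℝ) (-formalAd ℝ (Ω t)) Ω') t ∧
      HasCoeffDerivAt (fun s => formalExp ℝ (Ω s))
        (formalApply ℝ (expQuot ℝ) (formalAd ℝ (Ω t)) Ω' * formalExp ℝ (Ω t)) t := by
  have hΩ : HasCoeffDerivAt Ω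
      (PowerSeries.mk fun n => deriv (fun s => PowerSeries.coeff n (Ω s)) t) t := fun n => by
    rw [PowerSeries.coeff_mk]
    exact (differentiable_coeff_of_formalExp h0 hY n t).hasDerivAt
  have h0' : PowerSeries.coeff 0
      (PowerSeries.mk fun n => deriv (fun s => PowerSeries.coeff n (Ω s)) t) = 0 := by
    rw [PowerSeries.coeff_mk]
    simp only [h0]
    exact deriv_const _ _
  refine ⟨_, hΩ, fun n => ?_, fun n => ?_⟩
  · rw [coeff_formalExp_mul_derivative (h0 t)]
    exact hΩ.coeff_formalExp h0 h0' n
  · rw [coeff_derivative_mul_formalExp (h0 t)]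
    exact hΩ.coeff_formalExp h0 h0' n

theorem raisesDegree_formalAd {K : Type*} [Field K] {R : Type*} [Ring R] [Algebra K R] {x : R⟦X⟧}
    (hx : PowerSeries.coeff 0 x = 0) : RaisesDegree (formalAd K x) :=
  (raisesDegree_mulLeft hx).sub (raisesDegree_mulRight hx)

theorem raisesDegree_neg_formalAd {K : Type*} [Field K] {R : Type*} [Ring R] [Algebra K R]
    {x : R⟦X⟧} (hx : PowerSeries.coeff 0 x = 0) : RaisesDegree (-formalAd K x) := by
  rw [formalAd, neg_sub]
  exact (raisesDegree_mulRight hx).sub (raisesDegree_mulLeft hx)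

theorem formalApply_bernoulliSeries_expQuot {K : Type*} [Field K] [CharZero K] {R : Type*} [Ring R]
    [Algebra K R] {T : Module.End K R⟦X⟧} (hT : RaisesDegree T) (y : R⟦X⟧) :
    formalApply K (bernoulliSeries K) T (formalApply K (expQuot K) T y) = y := by
  rw [← hT.formalApply_mul, bernoulliSeries_mul_expQuot, formalApply_one]

/-- The Magnus formula for `Y' = Y Z`, where `Y = exp Ω`. -/
theorem hasCoeffDerivAt_log_of_right {Ω Z : ℝ → 𝔸⟦X⟧}
    (h0 : ∀ t, PowerSeries.coeff 0 (Ω t) = 0)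
    (hY : ∀ t, HasCoeffDerivAt (fun s => formalExp ℝ (Ω s)) (formalExp ℝ (Ω t) * Z t) t) (t : ℝ) :
    HasCoeffDerivAt Ω
      (formalApply ℝ (bernoulliSeries ℝ) (-formalAd ℝ (Ω t)) (Z t)) t := by
  obtain ⟨Ω', hΩ, h, -⟩ := exists_hasCoeffDerivAt_of_formalExp h0
    (fun n t => (hY t n).differentiableAt) t
  -- Comparing the two expressions for the derivative and cancelling `exp Ω` gives `Z` as the
  -- `expQuot` series in `-ad_Ω` applied to `Ω'`; the Bernoulli series then recovers `Ω'`.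
  have hZ := congrArg (formalExp ℝ (-Ω t) * ·) ((hY t).unique h)
  simp only [← mul_assoc, formalExp_neg_mul_formalExp (h0 t), one_mul] at hZ
  rwa [hZ, formalApply_bernoulliSeries_expQuot (raisesDegree_neg_formalAd (h0 t))]

/-- The Magnus formula for `Y' = Z Y`, where `Y = exp Ω`. -/
theorem hasCoeffDerivAt_log_of_left {Ω Z : ℝ → 𝔸⟦X⟧}
    (h0 : ∀ t, PowerSeries.coeff 0 (Ω t) = 0)
    (hY : ∀ t, HasCoeffDerivAt (fun s => formalExp ℝ (Ω s)) (Z t * formalExp ℝ (Ω t)) t) (t : ℝ) :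
    HasCoeffDerivAt Ω
      (formalApply ℝ (bernoulliSeries ℝ) (formalAd ℝ (Ω t)) (Z t)) t := by
  obtain ⟨Ω', hΩ, -, h⟩ := exists_hasCoeffDerivAt_of_formalExp h0
    (fun n t => (hY t n).differentiableAt) t
  have hZ := congrArg (· * formalExp ℝ (-Ω t)) ((hY t).unique h)
  simp only [mul_assoc, formalExp_mul_formalExp_neg (h0 t), mul_one] at hZ
  rwa [hZ, formalApply_bernoulliSeries_expQuot (raisesDegree_formalAd (h0 t))]

end Magnus
end LogDer

theorem mainTheorem1 {K : Type*} [Field K] [CharZero K] {L : Type*} [LieRing L] [LieAlgebra K L]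
    (ℒ : ℕ → Submodule K L) [GradedLieAlgebra ℒ] (hpos : ℒ 0 = ⊥)
    (δ : LogDer.GradedLieDerivation ℒ) :
    (∀ l : LogDer.completedL ℒ,
      δ.logDerivative (LogDer.expL ℒ l) = LogDer.expL ℒ (-l) * δ.onU (LogDer.expL ℒ l) ∧
      δ.logDerivative (LogDer.expL ℒ l)
        = LogDer.ofL ℒ (LogDer.applyAd ℒ (LogDer.expNegQuot K) l (δ.onL l))) ∧
    -- the classical Magnus formula, formal in a parameter (the power series variable)
    (∀ (𝔸 : Type*) [NormedRing 𝔸] [NormedAlgebra ℝ 𝔸] (A : ℝ → 𝔸) (Y Ω : ℝ → 𝔸⟦X⟧),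
      Y 0 = 1 →
      (∀ t, PowerSeries.constantCoeff (Ω t) = 0) →
      (∀ t, LogDer.formalExp ℝ (Ω t) = Y t) →
      ((∀ n t, HasDerivAt (fun s => PowerSeries.coeff n (Y s))
          (PowerSeries.coeff n (Y t * (PowerSeries.X * PowerSeries.C (A t)))) t) →
        ∀ n t, HasDerivAt (fun s => PowerSeries.coeff n (Ω s))
          (PowerSeries.coeff n (LogDer.formalApply ℝ (LogDer.bernoulliSeries ℝ)
            (-LogDer.formalAd ℝ (Ω t)) (PowerSeries.X * PowerSeries.C (A t)))) t) ∧
      ((∀ n t, HasDerivAt (fun s => PowerSeries.coeff n (Y s))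
          (PowerSeries.coeff n ((PowerSeries.X * PowerSeries.C (A t)) * Y t)) t) →
        ∀ n t, HasDerivAt (fun s => PowerSeries.coeff n (Ω s))
          (PowerSeries.coeff n (LogDer.formalApply ℝ (LogDer.bernoulliSeries ℝ)
            (LogDer.formalAd ℝ (Ω t)) (PowerSeries.X * PowerSeries.C (A t)))) t)) := by
  refine ⟨fun l => ?_, fun 𝔸 _ _ A Y Ω _ h0 hY => ?_⟩
  · have h := LogDer.logDerivative_expL ℒ hpos δ l
    exact ⟨h, h.trans (LogDer.expL_neg_mul_onU_expL hpos δ l)⟩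
  -- The solution is replaced by `exp Ω`, so the differential equations become statements about the
  -- derivative of an exponential.
  · obtain rfl : (fun t => LogDer.formalExp ℝ (Ω t)) = Y := funext hY
    have h0' : ∀ t, PowerSeries.coeff 0 (Ω t) = 0 := fun t => by
      rw [PowerSeries.coeff_zero_eq_constantCoeff_apply, h0]
    exact ⟨fun h n t => LogDer.hasCoeffDerivAt_log_of_right
        (Z := fun t => PowerSeries.X * PowerSeries.C (A t)) h0' (fun t n => h n t) t n,
      fun h n t => LogDer.hasCoeffDerivAt_log_of_left
        (Z := fun t => PowerSeries.X * PowerSeries.C (A t)) h0' (fun t n => h n t) t n⟩
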